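/- Let $m,n\in\mathbb N$, let $0<p<1$, and let $\Phi: M_m(\mathbb C)\to M_n(\mathbb C)$ be a unital Schwarz map, that is, a linear map with $\Phi(\mathbf 1)=\mathbf 1$ and $\Phi(K^*K)\ge \Phi(K)^*\Phi(K)$ (in the positive semidefinite order) for all $K\in M_m(\mathbb C)$. Let $\Phi^\dagger: M_n(\mathbb C)\to M_m(\mathbb C)$ be the adjoint of $\Phi$ for the Hilbert--Schmidt inner products, so that $\operatorname{tr}[X^*\Phi^\dagger(Y)]=\operatorname{tr}[\Phi(X)^*Y]$ for all $X\in M_m(\mathbb C)$, $Y\in M_n(\mathbb C)$. Then for every positive definite $A\in M_n(\mathbb C)$ and every invertible $B\in M_n(\mathbb C)$, $$\operatorname{tr}\big[(B^*A^{-p}B)^{1/(2-p)}\big]\ \ge\ \operatorname{tr}\big[(\Phi^\dagger(B)^*\,\Phi^\dagger(A)^{-p}\,\Phi^\dagger(B))^{1/(2-p)}\big].$$ Here real powers of positive semidefinite matrices are defined by the functional calculus; if $\Phi^\dagger(A)$ is singular, then $\Phi^\dagger(A)^{-p}$ denotes the $p$-th power of its Moore--Penrose generalized inverse. -/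

import Mathlib

open scoped Matrix ComplexOrder MatrixOrder

namespace SchwarzMono

/-- A Schwarz map between matrix algebras: a linear map `Φ` with `Φ(K* K) ≥ Φ(K)* Φ(K)` for every
matrix `K`, in the Loewner order (the difference is positive semidefinite). -/
def IsSchwarz {m n : ℕ}
    (Φ : Matrix (Fin m) (Fin m) ℂ →ₗ[ℂ] Matrix (Fin n) (Fin n) ℂ) : Prop :=
  ∀ K : Matrix (Fin m) (Fin m) ℂ, (Φ (Kᴴ * K) - (Φ K)ᴴ * Φ K).PosSemidef

/-- A unital map: it sends the identity matrix to the identity matrix. -/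
def IsUnital {m n : ℕ}
    (Φ : Matrix (Fin m) (Fin m) ℂ →ₗ[ℂ] Matrix (Fin n) (Fin n) ℂ) : Prop :=
  Φ 1 = 1

/-- The adjoint of `Φ` for the Hilbert-Schmidt inner products `⟨X, Y⟩ = tr (X* Y)`.  Its
`(i, j)` entry at `Y` is `⟨Φ E, Y⟩`, where `E` is the matrix unit with a one at `(i, j)`; the
defining property and uniqueness are proved below. -/
def hsAdjoint {m n : ℕ}
    (Φ : Matrix (Fin m) (Fin m) ℂ →ₗ[ℂ] Matrix (Fin n) (Fin n) ℂ) :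
    Matrix (Fin n) (Fin n) ℂ →ₗ[ℂ] Matrix (Fin m) (Fin m) ℂ where
  toFun Y := Matrix.of fun i j => ((Φ (Matrix.single i j 1))ᴴ * Y).trace
  map_add' Y Z := by
    ext i j
    simp [Matrix.mul_add]
  map_smul' c Y := by
    ext i j
    simp

theorem trace_hsAdjoint {m n : ℕ}
    (Φ : Matrix (Fin m) (Fin m) ℂ →ₗ[ℂ] Matrix (Fin n) (Fin n) ℂ)
    (X : Matrix (Fin m) (Fin m) ℂ) (Y : Matrix (Fin n) (Fin n) ℂ) :
    (Xᴴ * hsAdjoint Φ Y).trace = ((Φ X)ᴴ * Y).trace := by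
  have hX : Φ X = ∑ i, ∑ j, X i j • Φ (Matrix.single i j 1) := by
    conv_lhs => rw [Matrix.matrix_eq_sum_single X]
    simp only [map_sum]
    refine Finset.sum_congr rfl fun i _ => Finset.sum_congr rfl fun j _ => ?_
    rw [← map_smul, Matrix.smul_single, smul_eq_mul, mul_one]
  rw [hX]
  simp only [Matrix.conjTranspose_sum, Matrix.conjTranspose_smul, Matrix.sum_mul,
    Matrix.trace_sum, Matrix.smul_mul, Matrix.trace_smul, smul_eq_mul]
  rw [Finset.sum_comm]
  simp [Matrix.trace, Matrix.mul_apply, hsAdjoint]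

theorem hsAdjoint_unique {m n : ℕ}
    (Φ : Matrix (Fin m) (Fin m) ℂ →ₗ[ℂ] Matrix (Fin n) (Fin n) ℂ)
    (Ψ : Matrix (Fin n) (Fin n) ℂ → Matrix (Fin m) (Fin m) ℂ)
    (h : ∀ X Y, (Xᴴ * Ψ Y).trace = ((Φ X)ᴴ * Y).trace) (Y : Matrix (Fin n) (Fin n) ℂ) :
    Ψ Y = hsAdjoint Φ Y := by
  ext i j
  have := h (Matrix.single i j 1) Y
  simp only [hsAdjoint, LinearMap.coe_mk, AddHom.coe_mk, Matrix.of_apply]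
  rw [← this, Matrix.conjTranspose_single, star_one, Matrix.trace_single_mul]
  simp

/-- Mathlib's real powers of a positive semidefinite matrix, read off in an orthonormal eigenbasis:
each eigenvalue `x` becomes `x ^ y`.  As `(0 : ℝ) ^ y = 0` for `y ≠ 0`, a nonzero power of a singular
matrix vanishes on its kernel, so a negative power is the positive power of the Moore-Penrose
generalized inverse. -/
theorem rpow_eq_of_posSemidef {n : ℕ} (A : Matrix (Fin n) (Fin n) ℂ) (hA : A.PosSemidef)
    (y : ℝ) :
    A ^ y = hA.1.eigenvectorUnitary.val *
      Matrix.diagonal (fun i => ((hA.1.eigenvalues i ^ y : ℝ) : ℂ)) *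
        star hA.1.eigenvectorUnitary.val := by
  have h0 : 0 ≤ A := hA.nonneg
  rw [CFC.rpow_eq_cfc_real h0, hA.1.cfc_eq, Matrix.IsHermitian.cfc]
  rfl

end SchwarzMono

open Matrix MeasureTheory

namespace SchwarzMono

/-! With `s = 1 / (2 - p)`, Young's inequality gives `tr Y ^ s = min over Z > 0 of s tr (Y Z ^ (p -
1)) + (1 - s) tr Z` for `Y > 0`, attained at `Z = Y ^ s` (`trace_rpow_le`, `trace_rpow_eq`). For `Y
= B* A ^ (-p) B` the first term decreases when `A, B, Z` are replaced by their images under `Φ†`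
(`sandwich_neg_rpow_le`), and `tr Z` is preserved since `Φ` is unital.

That monotonicity is the Legendre dual of `sandwich_rpow_le`, which interpolates between the Schwarz
inequalities for `K` and `K*`: `a ^ p z ^ (1 - p)` is a positive integral of parallel sums of `a`
and `t z`, and a parallel sum is an infimum over splittings `K + L`, which a linear map respects. -/

/-- The quadratic form `K ↦ re tr (K* A K Z)`. -/
noncomputable def sandwich {n : ℕ} (A Z K : Matrix (Fin n) (Fin n) ℂ) : ℝ :=
  (Kᴴ * A * K * Z).trace.re

/-- The conjugate by `U` of a real diagonal matrix. -/
noncomputable def conjDiag {n : ℕ} (U : Matrix (Fin n) (Fin n) ℂ) (a : Fin n → ℝ) :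
    Matrix (Fin n) (Fin n) ℂ :=
  U * diagonal (fun i => (a i : ℂ)) * Uᴴ

theorem exists_conjDiag {n : ℕ} {A : Matrix (Fin n) (Fin n) ℂ} (hA : A.PosSemidef) :
    ∃ (U : Matrix (Fin n) (Fin n) ℂ) (a : Fin n → ℝ), U * Uᴴ = 1 ∧ Uᴴ * U = 1 ∧ (∀ i, 0 ≤ a i) ∧
      (A.PosDef → ∀ i, 0 < a i) ∧ A = conjDiag U a ∧
      ∀ y : ℝ, A ^ y = conjDiag U (fun i => a i ^ y) := by
  refine ⟨hA.1.eigenvectorUnitary.val, hA.1.eigenvalues,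
    Unitary.mul_star_self_of_mem hA.1.eigenvectorUnitary.2,
    Unitary.star_mul_self_of_mem hA.1.eigenvectorUnitary.2, hA.eigenvalues_nonneg,
    fun h => h.eigenvalues_pos, ?_, fun y => rpow_eq_of_posSemidef A hA y⟩
  have h := rpow_eq_of_posSemidef A hA 1
  rw [CFC.rpow_one A hA.nonneg] at h
  simpa [conjDiag, star_eq_conjTranspose] using h

/-- Left multiplication by `A` and right multiplication by `Z` commute, so eigenbases of both
diagonalise the form and reduce trace inequalities to scalar ones. -/
theorem sandwich_conjDiag {n : ℕ} (U V : Matrix (Fin n) (Fin n) ℂ) (α β : Fin n → ℝ)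
    (K : Matrix (Fin n) (Fin n) ℂ) :
    sandwich (conjDiag U α) (conjDiag V β) K =
      ∑ i, ∑ j, α i * β j * Complex.normSq ((Uᴴ * K * V) i j) := by
  have h : (Kᴴ * conjDiag U α * K * conjDiag V β).trace =
      ((Uᴴ * K * V)ᴴ * (diagonal (fun i => (α i : ℂ)) * (Uᴴ * K * V) *
        diagonal (fun i => (β i : ℂ)))).trace := by
    simp only [conjDiag, conjTranspose_mul, conjTranspose_conjTranspose]
    rw [← Matrix.mul_assoc, Matrix.trace_mul_comm]
    simp only [Matrix.mul_assoc]
  rw [sandwich, h, Matrix.trace, Complex.re_sum, Finset.sum_comm]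
  refine Finset.sum_congr rfl fun j _ => ?_
  rw [diag_apply, Matrix.mul_apply, Complex.re_sum]
  refine Finset.sum_congr rfl fun i _ => ?_
  rw [mul_diagonal, diagonal_mul, conjTranspose_apply, Complex.normSq_apply]
  simp
  ring

theorem conjDiag_one {n : ℕ} {U : Matrix (Fin n) (Fin n) ℂ} (hU : U * Uᴴ = 1) :
    conjDiag U (fun _ => 1) = 1 := by
  simp [conjDiag, hU]

theorem conjDiag_mul {n : ℕ} {U : Matrix (Fin n) (Fin n) ℂ} (hU : Uᴴ * U = 1)
    (a b : Fin n → ℝ) : conjDiag U a * conjDiag U b = conjDiag U (fun i => a i * b i) := by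
  calc conjDiag U a * conjDiag U b
      = U * (diagonal (fun i => (a i : ℂ)) * (Uᴴ * U) * diagonal (fun i => (b i : ℂ))) * Uᴴ := by
        simp only [conjDiag, Matrix.mul_assoc]
    _ = _ := by simp [hU, conjDiag]

theorem sandwich_one_right {n : ℕ} (A K : Matrix (Fin n) (Fin n) ℂ) :
    sandwich A 1 K = (Kᴴ * A * K).trace.re := by
  simp [sandwich]

theorem sandwich_one_left {n : ℕ} (Z K : Matrix (Fin n) (Fin n) ℂ) :
    sandwich 1 Z K = (Kᴴ * K * Z).trace.re := by
  simp [sandwich]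

/-! ### Parallel sums as infima over splittings. -/

section ParallelSum

variable {n : ℕ} {U V : Matrix (Fin n) (Fin n) ℂ} {a z : Fin n → ℝ}

/-- After multiplication by `a + b`, the gap is `|a x - b y| ^ 2`. -/
theorem parallel_mul_normSq_le {a b : ℝ} (ha : 0 ≤ a) (hb : 0 ≤ b) (x y : ℂ) :
    a * b / (a + b) * Complex.normSq (x + y) ≤ a * Complex.normSq x + b * Complex.normSq y := by
  rcases (add_nonneg ha hb).eq_or_lt with h | h
  · rw [← h]
    have := Complex.normSq_nonneg x
    have := Complex.normSq_nonneg y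
    simp only [div_zero, zero_mul]
    positivity
  · rw [div_mul_eq_mul_div, div_le_iff₀ h]
    simp only [Complex.normSq_apply, Complex.add_re, Complex.add_im]
    nlinarith [sq_nonneg (a * x.re - b * y.re), sq_nonneg (a * x.im - b * y.im)]

theorem parallel_form_add_le (hU : U * Uᴴ = 1) (hV : V * Vᴴ = 1) (ha : ∀ i, 0 ≤ a i)
    (hz : ∀ i, 0 ≤ z i) {t : ℝ} (ht : 0 ≤ t) (K L : Matrix (Fin n) (Fin n) ℂ) :
    ∑ i, ∑ j, a i * (t * z j) / (a i + t * z j) * Complex.normSq ((Uᴴ * (K + L) * V) i j) ≤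
      sandwich (conjDiag U a) 1 K + t * sandwich 1 (conjDiag V z) L := by
  rw [← conjDiag_one hV, sandwich_conjDiag, conjDiag_one hV, ← conjDiag_one hU, sandwich_conjDiag,
    Finset.mul_sum, ← Finset.sum_add_distrib]
  refine Finset.sum_le_sum fun i _ => ?_
  rw [Finset.mul_sum, ← Finset.sum_add_distrib]
  refine Finset.sum_le_sum fun j _ => ?_
  rw [Matrix.mul_add, Matrix.add_mul, Matrix.add_apply]
  refine (parallel_mul_normSq_le (ha i) (mul_nonneg ht (hz j)) _ _).trans (le_of_eq ?_)
  ring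

theorem exists_parallel_form_eq (hU : U * Uᴴ = 1) (hU' : Uᴴ * U = 1) (hV : V * Vᴴ = 1)
    (hV' : Vᴴ * V = 1) (ha : ∀ i, 0 ≤ a i) (hz : ∀ i, 0 ≤ z i) {t : ℝ} (ht : 0 ≤ t)
    (M : Matrix (Fin n) (Fin n) ℂ) :
    ∃ K L, K + L = M ∧ sandwich (conjDiag U a) 1 K + t * sandwich 1 (conjDiag V z) L =
      ∑ i, ∑ j, a i * (t * z j) / (a i + t * z j) * Complex.normSq ((Uᴴ * M * V) i j) := by
  set k := Uᴴ * M * V with hk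
  -- The entrywise minimiser: `a x = b y` and `x + y = k` force `y = a k / (a + b)`, with `b = t z`.
  set l : Matrix (Fin n) (Fin n) ℂ :=
    of fun i j => ((a i / (a i + t * z j) : ℝ) : ℂ) * k i j with hl
  have key (X : Matrix (Fin n) (Fin n) ℂ) : Uᴴ * (U * X * Vᴴ) * V = X := by
    calc Uᴴ * (U * X * Vᴴ) * V = (Uᴴ * U) * X * (Vᴴ * V) := by simp only [Matrix.mul_assoc]
      _ = X := by simp [hU', hV']
  refine ⟨U * (k - l) * Vᴴ, U * l * Vᴴ, ?_, ?_⟩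
  · calc U * (k - l) * Vᴴ + U * l * Vᴴ = U * k * Vᴴ := by
          rw [← Matrix.add_mul, ← Matrix.mul_add, sub_add_cancel]
      _ = (U * Uᴴ) * M * (V * Vᴴ) := by simp only [hk, Matrix.mul_assoc]
      _ = M := by simp [hU, hV]
  · rw [← conjDiag_one hV, sandwich_conjDiag, conjDiag_one hV, ← conjDiag_one hU,
      sandwich_conjDiag, Finset.mul_sum, ← Finset.sum_add_distrib]
    refine Finset.sum_congr rfl fun i _ => ?_
    rw [Finset.mul_sum, ← Finset.sum_add_distrib]
    refine Finset.sum_congr rfl fun j _ => ?_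
    have hb : 0 ≤ t * z j := mul_nonneg ht (hz j)
    have h1 : (k - l) i j = ((1 - a i / (a i + t * z j) : ℝ) : ℂ) * k i j := by
      simp [hl]; ring
    have h2 : l i j = ((a i / (a i + t * z j) : ℝ) : ℂ) * k i j := rfl
    rw [key, key, h1, h2, Complex.normSq_mul, Complex.normSq_mul, Complex.normSq_ofReal,
      Complex.normSq_ofReal]
    rcases (add_nonneg (ha i) hb).eq_or_lt with h | h
    · have h3 : a i = 0 := by linarith [ha i]
      have h4 : t * z j = 0 := by linarith [ha i]
      simp [h3, h4]
    · field_simp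
      ring

end ParallelSum

/-! ### Interpolation between the two endpoint forms. -/

theorem rpow_mul_rpow_one_sub_eq {p a z : ℝ} (hp1 : p < 1) (ha : 0 ≤ a)
    (hz : 0 ≤ z) : a ^ p * z ^ (1 - p) = z * (a / z) ^ p := by
  rcases hz.eq_or_lt with h | h
  · simp [← h, Real.zero_rpow (sub_pos.2 hp1).ne']
  · rw [Real.div_rpow ha hz, Real.rpow_sub h, Real.rpow_one]
    ring

/-- The perspective of the integrand for `x ^ p` is a positive multiple of the parallel sum of `a`
and `t z`. -/
theorem mul_rpowIntegrand_div {p a z t : ℝ} (hp : p ∈ Set.Ioo (0 : ℝ) 1) (ha : 0 ≤ a)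
    (hz : 0 ≤ z) (ht : 0 < t) :
    z * p.rpowIntegrand₀₁ t (a / z) = t ^ (p - 1) / t * (a * (t * z) / (a + t * z)) := by
  rw [Real.rpowIntegrand₀₁_eq_pow_div hp ht.le (by positivity)]
  rcases hz.eq_or_lt with h | h
  · simp [← h]
  · have : a + t * z ≠ 0 := by positivity
    have : t + a / z ≠ 0 := by positivity
    have : t * z + a ≠ 0 := by positivity
    field_simp
    ring

/-- If a linear map contracts the quadratic forms `tr (K* A K)` and `tr (K* K Z)`, then it contracts
the interpolating forms `tr (K* A ^ p K Z ^ (1 - p))`. -/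
theorem sandwich_rpow_le {m n : ℕ} {p : ℝ} (hp0 : 0 < p) (hp1 : p < 1)
    (Φ : Matrix (Fin m) (Fin m) ℂ →ₗ[ℂ] Matrix (Fin n) (Fin n) ℂ)
    {A Z : Matrix (Fin n) (Fin n) ℂ} {A' Z' : Matrix (Fin m) (Fin m) ℂ}
    (hA : A.PosSemidef) (hZ : Z.PosSemidef) (hA' : A'.PosSemidef) (hZ' : Z'.PosSemidef)
    (h1 : ∀ K, sandwich A 1 (Φ K) ≤ sandwich A' 1 K)
    (h2 : ∀ K, sandwich 1 Z (Φ K) ≤ sandwich 1 Z' K) (K : Matrix (Fin m) (Fin m) ℂ) :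
    sandwich (A ^ p) (Z ^ (1 - p)) (Φ K) ≤ sandwich (A' ^ p) (Z' ^ (1 - p)) K := by
  obtain ⟨U, a, hU, hU2, ha, -, rfl, hApow⟩ := exists_conjDiag hA
  obtain ⟨V, z, hV, hV2, hz, -, rfl, hZpow⟩ := exists_conjDiag hZ
  obtain ⟨U', a', hU', hU2', ha', -, rfl, hApow'⟩ := exists_conjDiag hA'
  obtain ⟨V', z', hV', hV2', hz', -, rfl, hZpow'⟩ := exists_conjDiag hZ'
  rw [hApow, hZpow, hApow', hZpow', sandwich_conjDiag, sandwich_conjDiag]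
  have hp : p ∈ Set.Ioo (0 : ℝ) 1 := ⟨hp0, hp1⟩
  obtain ⟨μ, hμ⟩ := Real.exists_measure_rpow_eq_integral_rpowIntegrand₀₁ hp
  have hint {N : ℕ} {b w : Fin N → ℝ} (hb : ∀ i, 0 ≤ b i) (hw : ∀ i, 0 ≤ w i)
      (k : Matrix (Fin N) (Fin N) ℂ) :
      IntegrableOn (fun t => ∑ i, ∑ j,
        w j * p.rpowIntegrand₀₁ t (b i / w j) * Complex.normSq (k i j)) (Set.Ioi 0) μ ∧
      ∑ i, ∑ j, b i ^ p * w j ^ (1 - p) * Complex.normSq (k i j) =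
        ∫ t in Set.Ioi 0, ∑ i, ∑ j,
          w j * p.rpowIntegrand₀₁ t (b i / w j) * Complex.normSq (k i j) ∂μ := by
    have hi (i j) : IntegrableOn (fun t =>
        w j * p.rpowIntegrand₀₁ t (b i / w j) * Complex.normSq (k i j)) (Set.Ioi 0) μ :=
      ((hμ _ (div_nonneg (hb i) (hw j))).1.const_mul _).mul_const _
    refine ⟨integrable_finsetSum _ fun i _ => integrable_finsetSum _ fun j _ => hi i j, ?_⟩
    rw [integral_finsetSum _ fun i _ => integrable_finsetSum _ fun j _ => hi i j]
    refine Finset.sum_congr rfl fun i _ => ?_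
    rw [integral_finsetSum _ fun j _ => hi i j]
    refine Finset.sum_congr rfl fun j _ => ?_
    rw [integral_mul_const, integral_const_mul, ← (hμ _ (div_nonneg (hb i) (hw j))).2,
      rpow_mul_rpow_one_sub_eq hp1 (hb i) (hw j)]
  rw [(hint ha hz _).2, (hint ha' hz' _).2]
  refine setIntegral_mono_on (hint ha hz _).1 (hint ha' hz' _).1 measurableSet_Ioi fun t ht => ?_
  have ht : 0 < t := ht
  have hfac {N : ℕ} {b w : Fin N → ℝ} (hb : ∀ i, 0 ≤ b i) (hw : ∀ i, 0 ≤ w i)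
      (k : Matrix (Fin N) (Fin N) ℂ) :
      ∑ i, ∑ j, w j * p.rpowIntegrand₀₁ t (b i / w j) * Complex.normSq (k i j) =
        t ^ (p - 1) / t *
          ∑ i, ∑ j, b i * (t * w j) / (b i + t * w j) * Complex.normSq (k i j) := by
    simp only [Finset.mul_sum]
    refine Finset.sum_congr rfl fun i _ => Finset.sum_congr rfl fun j _ => ?_
    rw [mul_rpowIntegrand_div hp (hb i) (hw j) ht]
    ring
  rw [hfac ha hz, hfac ha' hz']
  refine mul_le_mul_of_nonneg_left ?_ (by positivity)
  -- The optimal splitting of `K` is mapped by `Φ` to a competitor for `Φ K`.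
  obtain ⟨K₁, K₂, rfl, hK⟩ := exists_parallel_form_eq hU' hU2' hV' hV2' ha' hz' ht.le K
  rw [← hK, map_add]
  refine (parallel_form_add_le hU hV ha hz ht.le _ _).trans ?_
  exact add_le_add (h1 K₁) (mul_le_mul_of_nonneg_left (h2 K₂) ht.le)

/-- Young's inequality for traces of powers with exponent `1 / (2 - p) ∈ (1 / 2, 1)`. -/
theorem trace_rpow_le {n : ℕ} {p : ℝ} (hp1 : p < 1)
    {Y Z : Matrix (Fin n) (Fin n) ℂ} (hY : Y.PosSemidef) (hZ : Z.PosDef) :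
    (Y ^ (1 / (2 - p))).trace.re ≤
      1 / (2 - p) * (Y * Z ^ (p - 1)).trace.re + (1 - 1 / (2 - p)) * Z.trace.re := by
  obtain ⟨U, y, hU, hU2, hy, -, hYe, hYpow⟩ := exists_conjDiag hY
  obtain ⟨V, z, hV, hV2, -, hz, hZe, hZpow⟩ := exists_conjDiag hZ.posSemidef
  replace hz := hz hZ
  have hs : 0 < 2 - p := by linarith
  have hs1 : 1 / (2 - p) ≤ 1 := by rw [div_le_one hs]; linarith
  have e1 : (Y ^ (1 / (2 - p))).trace.re =
      sandwich (conjDiag U fun i => y i ^ (1 / (2 - p))) (conjDiag V fun _ => 1) 1 := by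
    rw [conjDiag_one hV, sandwich_one_right, hYpow]; simp
  have e2 : (Y * Z ^ (p - 1)).trace.re =
      sandwich (conjDiag U y) (conjDiag V fun i => z i ^ (p - 1)) 1 := by
    rw [hZpow, sandwich, ← hYe]; simp
  have e3 : Z.trace.re = sandwich (conjDiag U fun _ => 1) (conjDiag V z) 1 := by
    rw [conjDiag_one hU, sandwich_one_left, ← hZe]; simp
  rw [e1, e2, e3, sandwich_conjDiag, sandwich_conjDiag, sandwich_conjDiag, Finset.mul_sum,
    Finset.mul_sum, ← Finset.sum_add_distrib]
  refine Finset.sum_le_sum fun i _ => ?_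
  rw [Finset.mul_sum, Finset.mul_sum, ← Finset.sum_add_distrib]
  refine Finset.sum_le_sum fun j _ => ?_
  have hzp : 0 < z j ^ (p - 1) := Real.rpow_pos_of_pos (hz j) _
  -- Weighted AM-GM for `y z ^ (p - 1)` and `z`; the weight `1 / (2 - p)` is the one that cancels
  -- the powers of `z`.
  have young := Real.geom_mean_le_arith_mean2_weighted (w₁ := 1 / (2 - p))
    (w₂ := 1 - 1 / (2 - p)) (by positivity) (by linarith)
    (mul_nonneg (hy i) hzp.le) (hz j).le (by ring)
  rw [Real.mul_rpow (hy i) hzp.le, ← Real.rpow_mul (hz j).le, mul_assoc,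
    ← Real.rpow_add (hz j),
    show (p - 1) * (1 / (2 - p)) + (1 - 1 / (2 - p)) = 0 by field_simp; ring,
    Real.rpow_zero, mul_one] at young
  have := mul_le_mul_of_nonneg_right young (Complex.normSq_nonneg ((Uᴴ * (1 : Matrix (Fin n) (Fin n) ℂ) * V) i j))
  linarith

theorem trace_rpow_eq {n : ℕ} {p : ℝ} (hp1 : p < 1)
    {Y : Matrix (Fin n) (Fin n) ℂ} (hY : Y.PosDef) :
    Y * (Y ^ (1 / (2 - p))) ^ (p - 1) = Y ^ (1 / (2 - p)) := by
  have hs : 0 < 2 - p := by linarith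
  have hsp : IsStrictlyPositive Y := Matrix.isStrictlyPositive_iff_posDef.2 hY
  rw [CFC.rpow_rpow Y _ _ (by positivity) hsp]
  nth_rw 1 [← CFC.rpow_one Y hsp.nonneg]
  rw [← CFC.rpow_add hY.isUnit]
  congr 1
  field_simp
  ring

/-! ### Schwarz maps and their adjoints. -/

section Schwarz

variable {m n : ℕ} {Φ : Matrix (Fin m) (Fin m) ℂ →ₗ[ℂ] Matrix (Fin n) (Fin n) ℂ}

theorem IsSchwarz.posSemidef (hΦ : IsSchwarz Φ) (K : Matrix (Fin m) (Fin m) ℂ) :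
    (Φ (Kᴴ * K)).PosSemidef := by
  simpa using (hΦ K).add (posSemidef_conjTranspose_mul_self (Φ K))

/-- Polarisation: expanding `(1 + L)* (1 + L)` shows that `Φ L + Φ L*` is Hermitian; `L = K` and `L
= i K` together give the claim. -/
theorem IsSchwarz.map_conjTranspose (hΦ : IsSchwarz Φ) (K : Matrix (Fin m) (Fin m) ℂ) :
    Φ Kᴴ = (Φ K)ᴴ := by
  have h0 (L : Matrix (Fin m) (Fin m) ℂ) : (Φ (Lᴴ * L))ᴴ = Φ (Lᴴ * L) := (hΦ.posSemidef L).1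
  have hone : (Φ 1)ᴴ = Φ 1 := by simpa using h0 1
  have h1 (L : Matrix (Fin m) (Fin m) ℂ) : (Φ L)ᴴ + (Φ Lᴴ)ᴴ = Φ L + Φ Lᴴ := by
    have h := h0 (1 + L)
    have e : (1 + L)ᴴ * (1 + L) = 1 + L + Lᴴ + Lᴴ * L := by
      simp only [conjTranspose_add, conjTranspose_one]; noncomm_ring
    rw [e] at h
    simp only [map_add, conjTranspose_add, hone, h0 L] at h
    have h' := add_right_cancel h
    rw [add_assoc, add_assoc] at h'
    exact add_left_cancel h'
  have h2 := h1 K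
  have h3 := h1 (Complex.I • K)
  simp only [conjTranspose_smul, map_smul] at h3
  ext i j
  have h4 := congrFun (congrFun h2 i) j
  have h5 := congrFun (congrFun h3 i) j
  simp only [Matrix.add_apply, Matrix.smul_apply, smul_eq_mul, conjTranspose_apply,
    Complex.star_def, Complex.conj_I, map_neg, neg_neg] at h4 h5 ⊢
  linear_combination (-1 / 2) * h4 - (Complex.I / 2) * h5 +
    ((-starRingEnd ℂ (Φ K j i) + starRingEnd ℂ (Φ Kᴴ j i) - Φ K i j + Φ Kᴴ i j) / 2) *
      Complex.I_sq

theorem trace_mul_nonneg {n : ℕ} {P A : Matrix (Fin n) (Fin n) ℂ} (hP : P.PosSemidef)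
    (hA : A.PosSemidef) : 0 ≤ (P * A).trace := by
  obtain ⟨B, rfl⟩ := CStarAlgebra.nonneg_iff_eq_star_mul_self.1 hA.nonneg
  rw [← Matrix.mul_assoc, Matrix.trace_mul_comm, ← Matrix.mul_assoc]
  exact (hP.mul_mul_conjTranspose_same B).trace_nonneg

theorem trace_re_mul_le {n : ℕ} {P Q A : Matrix (Fin n) (Fin n) ℂ} (h : (Q - P).PosSemidef)
    (hA : A.PosSemidef) : (P * A).trace.re ≤ (Q * A).trace.re := by
  have := (Complex.le_def.1 (trace_mul_nonneg h hA)).1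
  rw [Matrix.sub_mul, trace_sub, Complex.sub_re, Complex.zero_re] at this
  linarith

theorem IsSchwarz.posSemidef_hsAdjoint (hΦ : IsSchwarz Φ) {A : Matrix (Fin n) (Fin n) ℂ}
    (hA : A.PosSemidef) : (hsAdjoint Φ A).PosSemidef := by
  refine .of_dotProduct_mulVec_nonneg ?_ fun v => ?_
  · ext i j
    change star (((Φ (single j i 1))ᴴ * A).trace) = ((Φ (single i j 1))ᴴ * A).trace
    rw [← trace_conjTranspose, conjTranspose_mul, conjTranspose_conjTranspose, hA.1.eq,
      ← hΦ.map_conjTranspose, conjTranspose_single, star_one, Matrix.trace_mul_comm]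
  · obtain ⟨K, hK⟩ := CStarAlgebra.nonneg_iff_eq_star_mul_self.1
      (posSemidef_vecMulVec_self_star v).nonneg
    have h := trace_hsAdjoint Φ (vecMulVec v (star v)) A
    rw [(posSemidef_vecMulVec_self_star v).1.eq, vecMulVec_mul, trace_vecMulVec,
      dotProduct_comm, ← dotProduct_mulVec] at h
    rw [h, hK, star_eq_conjTranspose, (hΦ.posSemidef K).1.eq]
    exact trace_mul_nonneg (hΦ.posSemidef K) hA

theorem IsSchwarz.sandwich_one_left_le (hΦ : IsSchwarz Φ) {Z : Matrix (Fin n) (Fin n) ℂ}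
    (hZ : Z.PosSemidef) (K : Matrix (Fin m) (Fin m) ℂ) :
    sandwich 1 Z (Φ K) ≤ sandwich 1 (hsAdjoint Φ Z) K := by
  have h := trace_hsAdjoint Φ (Kᴴ * K) Z
  rw [conjTranspose_mul, conjTranspose_conjTranspose, (hΦ.posSemidef K).1.eq] at h
  rw [sandwich_one_left, sandwich_one_left, h]
  exact trace_re_mul_le (hΦ K) hZ

/-- The Schwarz inequality for `K*`, rearranged by cyclicity of the trace. -/
theorem IsSchwarz.sandwich_one_right_le (hΦ : IsSchwarz Φ) {A : Matrix (Fin n) (Fin n) ℂ}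
    (hA : A.PosSemidef) (K : Matrix (Fin m) (Fin m) ℂ) :
    sandwich A 1 (Φ K) ≤ sandwich (hsAdjoint Φ A) 1 K := by
  have h := hΦ.sandwich_one_left_le hA Kᴴ
  rw [sandwich_one_left, sandwich_one_left, hΦ.map_conjTranspose] at h
  simp only [conjTranspose_conjTranspose, Matrix.mul_assoc] at h
  rw [Matrix.trace_mul_comm, Matrix.trace_mul_comm K] at h
  simpa [sandwich, Matrix.mul_assoc] using h

end Schwarz

/-! ### Duality and monotonicity with negative powers. -/

theorem sandwich_rpow_nonneg {n : ℕ} {A Z : Matrix (Fin n) (Fin n) ℂ} (hA : A.PosSemidef)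
    (hZ : Z.PosSemidef) (x y : ℝ) (K : Matrix (Fin n) (Fin n) ℂ) :
    0 ≤ sandwich (A ^ x) (Z ^ y) K := by
  obtain ⟨U, a, -, -, ha, -, -, hApow⟩ := exists_conjDiag hA
  obtain ⟨V, z, -, -, hz, -, -, hZpow⟩ := exists_conjDiag hZ
  rw [hApow, hZpow, sandwich_conjDiag]
  exact Finset.sum_nonneg fun i _ => Finset.sum_nonneg fun j _ => mul_nonneg
    (mul_nonneg (Real.rpow_nonneg (ha i) _) (Real.rpow_nonneg (hz j) _)) (Complex.normSq_nonneg _)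

/-- Completing the square: `P B R` represents the functional `K ↦ re tr (K* B)` in the form given by
`T, S`. -/
theorem sandwich_sub {n : ℕ} {T S P R : Matrix (Fin n) (Fin n) ℂ} (hPT : P * T = 1)
    (hSR : S * R = 1) (hP : Pᴴ = P) (hR : Rᴴ = R) (K B : Matrix (Fin n) (Fin n) ℂ) :
    sandwich T S (K - P * B * R) =
      sandwich T S K - 2 * (Kᴴ * B).trace.re + sandwich P R B := by
  have hTP : T * P = 1 := mul_eq_one_comm.1 hPT
  have hRS : R * S = 1 := mul_eq_one_comm.1 hSR
  have h2 : Kᴴ * T * (P * B * R) * S = Kᴴ * B := by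
    calc Kᴴ * T * (P * B * R) * S = Kᴴ * (T * P) * B * (R * S) := by simp only [Matrix.mul_assoc]
      _ = Kᴴ * B := by simp [hTP, hRS]
  have h3 : (R * Bᴴ * P * T * K * S).trace.re = (Kᴴ * B).trace.re := by
    calc (R * Bᴴ * P * T * K * S).trace.re = (R * (Bᴴ * (P * T) * K * S)).trace.re := by
          simp only [Matrix.mul_assoc]
      _ = (Bᴴ * K * (S * R)).trace.re := by
          rw [Matrix.trace_mul_comm, hPT, Matrix.mul_one, Matrix.mul_assoc _ S R]
      _ = ((Kᴴ * B)ᴴ).trace.re := by simp [hSR]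
      _ = (Kᴴ * B).trace.re := by rw [trace_conjTranspose, Complex.star_def, Complex.conj_re]
  have h4 : (R * Bᴴ * P * T * (P * B * R) * S).trace = (Bᴴ * P * B * R).trace := by
    calc (R * Bᴴ * P * T * (P * B * R) * S).trace
        = (R * (Bᴴ * (P * T) * P * B * (R * S))).trace := by simp only [Matrix.mul_assoc]
      _ = (Bᴴ * P * B * R).trace := by
          rw [Matrix.trace_mul_comm, hPT, hRS, Matrix.mul_one, Matrix.mul_one]
  have e : (K - P * B * R)ᴴ * T * (K - P * B * R) * S = Kᴴ * T * K * S -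
      Kᴴ * T * (P * B * R) * S - R * Bᴴ * P * T * K * S + R * Bᴴ * P * T * (P * B * R) * S := by
    simp only [conjTranspose_sub, conjTranspose_mul, hP, hR]
    noncomm_ring
  simp only [sandwich]
  rw [e, trace_add, trace_sub, trace_sub, Complex.add_re, Complex.sub_re, Complex.sub_re, h2, h3,
    h4]
  ring

/-- Assuming only `P T P = P` lets `P` be a generalized inverse, as a singular `Φ†(A)` requires. -/
theorem sandwich_mul_mul {n : ℕ} {T S P R : Matrix (Fin n) (Fin n) ℂ} (hPTP : P * T * P = P)
    (hRS : R * S = 1) (hP : Pᴴ = P) (hR : Rᴴ = R) (X : Matrix (Fin n) (Fin n) ℂ) :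
    sandwich T S (P * X * R) = sandwich P R X := by
  have : (P * X * R)ᴴ * T * (P * X * R) * S = R * (Xᴴ * (P * T * P) * X * (R * S)) := by
    simp only [conjTranspose_mul, hP, hR, Matrix.mul_assoc]
  rw [sandwich, this, hPTP, hRS, Matrix.mul_one, Matrix.trace_mul_comm, sandwich]

theorem trace_conjTranspose_mul_eq_sandwich {n : ℕ} {P R : Matrix (Fin n) (Fin n) ℂ}
    (hP : Pᴴ = P) (hR : Rᴴ = R) (X : Matrix (Fin n) (Fin n) ℂ) :
    ((P * X * R)ᴴ * X).trace.re = sandwich P R X := by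
  have : (P * X * R)ᴴ * X = R * (Xᴴ * P * X) := by
    simp only [conjTranspose_mul, hP, hR, Matrix.mul_assoc]
  rw [this, Matrix.trace_mul_comm, sandwich]

theorem conjTranspose_rpow {n : ℕ} (A : Matrix (Fin n) (Fin n) ℂ) (y : ℝ) :
    (A ^ y)ᴴ = A ^ y :=
  (CFC.rpow_nonneg (a := A) (y := y)).posSemidef.1

theorem rpow_neg_mul_rpow_mul_rpow_neg {n : ℕ} {A : Matrix (Fin n) (Fin n) ℂ}
    (hA : A.PosSemidef) (x : ℝ) : A ^ (-x) * A ^ x * A ^ (-x) = A ^ (-x) := by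
  obtain ⟨U, a, -, hU, ha, -, -, hApow⟩ := exists_conjDiag hA
  rw [hApow, hApow, conjDiag_mul hU, conjDiag_mul hU]
  congr 1
  ext i
  rw [Real.rpow_neg (ha i)]
  rcases eq_or_ne (a i ^ x) 0 with h | h
  · simp [h]
  · rw [inv_mul_cancel₀ h, one_mul]

/-- Monotonicity of `(A, B, Z) ↦ tr (B* A ^ (-p) B Z ^ (p - 1))` under the adjoint of a Schwarz
map. -/
theorem IsSchwarz.sandwich_neg_rpow_le {m n : ℕ} {p : ℝ} (hp0 : 0 < p) (hp1 : p < 1)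
    {Φ : Matrix (Fin m) (Fin m) ℂ →ₗ[ℂ] Matrix (Fin n) (Fin n) ℂ} (hΦ : IsSchwarz Φ)
    {A B Z : Matrix (Fin n) (Fin n) ℂ} {Z' : Matrix (Fin m) (Fin m) ℂ} (hA : A.PosDef)
    (hZ : Z.PosDef) (hZ' : Z'.PosDef) (hle : (Z' - hsAdjoint Φ Z).PosSemidef) :
    sandwich (hsAdjoint Φ A ^ (-p)) (Z' ^ (p - 1)) (hsAdjoint Φ B) ≤
      sandwich (A ^ (-p)) (Z ^ (p - 1)) B := by
  have hA' := hΦ.posSemidef_hsAdjoint hA.posSemidef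
  have hAs : IsStrictlyPositive A := Matrix.isStrictlyPositive_iff_posDef.2 hA
  have hZs : IsStrictlyPositive Z := Matrix.isStrictlyPositive_iff_posDef.2 hZ
  have hZs' : IsStrictlyPositive Z' := Matrix.isStrictlyPositive_iff_posDef.2 hZ'
  have hSR : Z ^ (1 - p) * Z ^ (p - 1) = 1 := by
    rw [← neg_sub 1 p]; exact CFC.rpow_mul_rpow_neg _ hZs
  have hRS' : Z' ^ (p - 1) * Z' ^ (1 - p) = 1 := by
    rw [← neg_sub 1 p]; exact CFC.rpow_neg_mul_rpow _ hZs'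
  -- The optimiser of the dual problem on the `Φ†` side.
  set W := hsAdjoint Φ A ^ (-p) * hsAdjoint Φ B * Z' ^ (p - 1) with hW
  have h1 := sandwich_rpow_le hp0 hp1 Φ hA.posSemidef hZ.posSemidef hA' hZ'.posSemidef
    (hΦ.sandwich_one_right_le hA.posSemidef) (fun K => by
      refine (hΦ.sandwich_one_left_le hZ.posSemidef K).trans ?_
      rw [sandwich_one_left, sandwich_one_left, Matrix.trace_mul_comm, Matrix.trace_mul_comm _ Z']
      exact trace_re_mul_le hle (posSemidef_conjTranspose_mul_self K)) W
  rw [hW, sandwich_mul_mul (rpow_neg_mul_rpow_mul_rpow_neg hA' p) hRS' (conjTranspose_rpow _ _)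
    (conjTranspose_rpow _ _), ← hW] at h1
  have h2 := sandwich_rpow_nonneg hA.posSemidef hZ.posSemidef p (1 - p)
    (Φ W - A ^ (-p) * B * Z ^ (p - 1))
  rw [sandwich_sub (CFC.rpow_neg_mul_rpow _ hAs) hSR (conjTranspose_rpow _ _)
    (conjTranspose_rpow _ _), ← trace_hsAdjoint, hW,
    trace_conjTranspose_mul_eq_sandwich (conjTranspose_rpow _ _) (conjTranspose_rpow _ _),
    ← hW] at h2
  -- With `S'` and `S` the left and right sides of the goal, `h1` and `h2` give `0 ≤ S' - 2 S' + S`.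
  linarith

theorem trace_hsAdjoint_of_isUnital {m n : ℕ}
    {Φ : Matrix (Fin m) (Fin m) ℂ →ₗ[ℂ] Matrix (Fin n) (Fin n) ℂ} (hΦ : IsUnital Φ)
    (Z : Matrix (Fin n) (Fin n) ℂ) : (hsAdjoint Φ Z).trace = Z.trace := by
  have h := trace_hsAdjoint Φ 1 Z
  rw [show Φ 1 = 1 from hΦ] at h
  simpa using h

end SchwarzMono

theorem theorem4p1 (m n : ℕ) (p : ℝ) (hp0 : 0 < p) (hp1 : p < 1)
    (Φ : Matrix (Fin m) (Fin m) ℂ →ₗ[ℂ] Matrix (Fin n) (Fin n) ℂ)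
    (hunital : SchwarzMono.IsUnital Φ) (hschwarz : SchwarzMono.IsSchwarz Φ)
    (A B : Matrix (Fin n) (Fin n) ℂ) (hA : A.PosDef) (hB : IsUnit B) :
    ((((SchwarzMono.hsAdjoint Φ B)ᴴ * (SchwarzMono.hsAdjoint Φ A) ^ (-p) *
        SchwarzMono.hsAdjoint Φ B) ^ (1 / (2 - p))).trace).re ≤
      (((Bᴴ * A ^ (-p) * B) ^ (1 / (2 - p))).trace).re := by
  have hAs : IsStrictlyPositive A := Matrix.isStrictlyPositive_iff_posDef.2 hA
  have hY : (Bᴴ * A ^ (-p) * B).PosDef :=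
    (Matrix.isStrictlyPositive_iff_posDef.1 (hAs.rpow A (-p))).conjTranspose_mul_mul_same
      (mulVec_injective_of_isUnit hB)
  have hY' : ((SchwarzMono.hsAdjoint Φ B)ᴴ * (SchwarzMono.hsAdjoint Φ A) ^ (-p) *
      SchwarzMono.hsAdjoint Φ B).PosSemidef :=
    CFC.rpow_nonneg.posSemidef.conjTranspose_mul_mul_same _
  have hZ : ((Bᴴ * A ^ (-p) * B) ^ (1 / (2 - p))).PosDef :=
    Matrix.isStrictlyPositive_iff_posDef.1
      ((Matrix.isStrictlyPositive_iff_posDef.2 hY).rpow _ _)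
  have hopt := SchwarzMono.trace_rpow_eq hp1 hY
  set Z := (Bᴴ * A ^ (-p) * B) ^ (1 / (2 - p)) with hZdef
  have hs : 0 < 2 - p := by linarith
  have hs0 : 0 < 1 / (2 - p) := by positivity
  have hs1 : 1 / (2 - p) ≤ 1 := by rw [div_le_one hs]; linarith
  refine le_of_forall_pos_le_add fun δ hδ => ?_
  -- `Φ†(Z)` may be singular, so `ε 1` is added to it at trace cost `ε m ≤ δ`; the denominator `m +
  -- 1` also covers `m = 0`.
  set ε : ℝ := δ / (m + 1) with hε
  have hεpos : 0 < ε := by positivity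
  have hεm : ε * m ≤ δ := by
    rw [hε, div_mul_eq_mul_div, div_le_iff₀ (by positivity)]; nlinarith
  have hε1 : ((ε : ℂ) • (1 : Matrix (Fin m) (Fin m) ℂ)).PosDef :=
    Matrix.PosDef.one.smul (by exact_mod_cast hεpos)
  have hZ' : (SchwarzMono.hsAdjoint Φ Z + (ε : ℂ) • 1).PosDef :=
    hε1.posSemidef_add (hschwarz.posSemidef_hsAdjoint hZ.posSemidef)
  have hmono := hschwarz.sandwich_neg_rpow_le hp0 hp1 (B := B) hA hZ hZ'
    (by simpa using hε1.posSemidef)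
  have hyoung := SchwarzMono.trace_rpow_le hp1 hY' hZ'
  have htr : (SchwarzMono.hsAdjoint Φ Z + (ε : ℂ) • 1).trace.re = Z.trace.re + ε * m := by
    simp [SchwarzMono.trace_hsAdjoint_of_isUnital hunital]
  rw [htr] at hyoung
  unfold SchwarzMono.sandwich at hmono
  rw [hopt] at hmono
  have h1 := mul_le_mul_of_nonneg_left hmono hs0.le
  have h2 : (1 - 1 / (2 - p)) * (ε * m) ≤ δ := by
    have : 0 ≤ ε * m := by positivity
    nlinarith
  linarith
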